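/- Let $D$ be an oriented link diagram on $S^2$ with ordered crossings $c^1,\dots,c^n$ and writhe $w_D$. A (Kauffman) state $x$ of $D$ is a choice of an $A$- or $B$-smoothing at each crossing; it consists of disjoint state circles together with one crossing arc, labeled $A$ or $B$, for each crossing. The state graph $G_x$ has the state circles as vertices and the crossing arcs as edges; its blocks are the pieces obtained by cutting $G_x$ simultaneously at all its cut vertices. The state $x$ is *homogeneously adequate* if each crossing arc joins two distinct state circles and no block contains both $A$- and $B$-type arcs. Let $x_A$ (resp. $x_B$) be the union of all $A$-type (resp. $B$-type) crossing arcs and their incident state circles; its connected components are the $A$-zones (resp. $B$-zones) of $x$, and $G_{x_A}$ is the graph of $x_A$. An *enhancement* $X$ of $x$ labels each state circle by $1$ or $0$. Put $i_x=\frac12\big(w_D-|A\text{-smoothings}|_x+|B\text{-smoothings}|_x\big)$ and $j_X=w_D+i_x-|1\text{-labeled circles}|_X+|0\text{-labeled circles}|_X$. For a ring $R$ with $1$, the Khovanov complex $\mathcal C_R(D)$ is the free $R$-module on all enhanced states of $D$, bigraded by $(i_x,j_X)$, with $dX=\sum_t(-1)^{a_t(X)}d_{c^t}X$, where $a_t(X)$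 is the number of crossings $c^s$, $s<t$, with $A$-smoothing in $X$, where $d_{c^t}X=0$ if $X$ has a $B$-smoothing at $c^t$, and where otherwise $d_{c^t}$ changes the $A$-smoothing at $c^t$ to a $B$-smoothing and changes labels by $q\otimes q\mapsto0$, $\;1\otimes q,\,q\otimes1\mapsto q$, $\;1\otimes1\mapsto1$ (two circles merge) and $q\mapsto q\otimes q$, $\;1\mapsto q\otimes1+1\otimes q$ (a circle splits); here the label $1$ is written $q$ and the label $0$ is written $1=q^0$. Let $\mathcal C_R^{i,j}(x)$ be the span of the enhancements of $x$ in bigrading $(i,j)$. Let $\sim_A$ be the equivalence relation on enhancements of $x$ generated by the move that interchanges the labels of two state circles which are joined by an $A$-type arc and carry different labels. Define $\operatorname{tr}_{\mathbb F_2}X=\sum_{Y\sim_AX}Y\in\mathcal C_{\mathbb F_2}(D)$ and, if $G_{x_A}$ is bipartite, $\operatorname{tr}_{\mathbb Z}X=\sum_{Y\sim_AX}\operatorname{sgn}(X\to Y)\,Y\in\mathcal C_{\mathbb Z}(D)$, where $\operatorname{sgn}(X\to Y)=\pm1$ according to whether an even or an odd number of moves takes $X$ to $Y$. **Theorem.**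 Let $x$ be a homogeneously adequate state of $D$. There is an integer $j_x$ such that for every point $p$ on $x$ away from the crossing arcs, $x$ has enhancements $X^-$, in which the state circle through $p$ is labeled $1$, and $X^+$, in which it is labeled $0$, which agree on all other state circles, with $j_{X^\pm}=j_x\pm1$, and such that $\operatorname{tr}_{\mathbb F_2}X^-\in\mathcal C_{\mathbb F_2}^{i_x,j_x-1}(x)$ and $\operatorname{tr}_{\mathbb F_2}X^+\in\mathcal C_{\mathbb F_2}^{i_x,j_x+1}(x)$ are cycles representing nonzero Khovanov homology classes over $\mathbb F_2$. If $G_{x_A}$ is bipartite, then for these same $X^\pm$ also $\operatorname{tr}_{\mathbb Z}X^\pm\in\mathcal C_{\mathbb Z}^{i_x,j_x\pm1}(x)$ are cycles representing nonzero Khovanov homology classes over $\mathbb Z$. If $D$ is connected, then $$j_x=w_D+i_x+|\bigcirc|_{x_B}-|\bigcirc|_{x_A}+\#(A\text{-zones of }x)-\#(B\text{-zones of }x),$$ where $|\bigcirc|_{x_A}$, $|\bigcirc|_{x_B}$ count the state circles of $x_A$, $x_B$. -/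

import Mathlib

noncomputable section

/-- Combinatorial data of an oriented link diagram on the sphere.  At each crossing the four
edge-ends are numbered `0, 1, 2, 3` in counterclockwise cyclic order, so that `0` and `2` are the
ends of the under-strand and `1` and `3` are the ends of the over-strand.  `edge` sends every
edge-end to the other end of the same edge, and `out` says whether the orientation of the link
points away from the crossing at that end.  `freeCircles` is the number of link components
that pass through no crossing. -/
structure DiagramData where
  crossings : ℕ
  freeCircles : ℕ
  edge : Fin crossings × Fin 4 → Fin crossings × Fin 4
  edge_edge : ∀ e, edge (edge e) = e
  edge_ne : ∀ e, edge e ≠ e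
  out : Fin crossings × Fin 4 → Bool
  out_edge : ∀ e, out (edge e) = !out e
  out_opposite : ∀ c k, out (c, k + 2) = !out (c, k)

namespace DiagramData

/-- The edge-ends of the diagram. -/
abbrev End (D : DiagramData) : Type := Fin D.crossings × Fin 4

/-- Consecutive edge-ends along the boundary of a face: traverse the edge, then turn to the next
edge-end around the crossing that has been reached. -/
def FaceStep (D : DiagramData) (e f : D.End) : Prop :=
  f = ((D.edge e).1, (D.edge e).2 + 1)

/-- The faces of the 4-valent graph formed by the crossings and edges. -/
def Face (D : DiagramData) : Type := Quot D.FaceStep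

/-- Two crossings are linked by an edge of the diagram. -/
def CrossingStep (D : DiagramData) (c c' : Fin D.crossings) : Prop :=
  ∃ k, (D.edge (c, k)).1 = c'

/-- The connected components of the 4-valent graph formed by the crossings and edges. -/
def Component (D : DiagramData) : Type := Quot D.CrossingStep

end DiagramData

/-- An oriented link diagram on the sphere.  The field `planar` is Euler's formula `V - E + F = 2C`
with `V` crossings, `E = 2V` edges, `F` faces and `C` components, i.e. every component of the
4-valent graph has genus zero.  (For a disconnected diagram only the relative position of its
components on the sphere is forgotten.) -/
structure LinkDiagram extends DiagramData where
  planar : Nat.card toDiagramData.Face = crossings + 2 * Nat.card toDiagramData.Component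

/-- The two ways of smoothing a crossing. -/
inductive Smoothing : Type
  | A
  | B
  deriving DecidableEq

instance : Finite Smoothing :=
  Finite.of_injective (fun a : Smoothing => decide (a = .A)) (by rintro (_ | _) (_ | _) <;> simp)

/-- How a smoothing reconnects the four edge-ends at a crossing.  The `A`-smoothing joins the two
regions swept out by turning the over-strand counterclockwise, hence pairs `0` with `1` and `2`
with `3`; the `B`-smoothing pairs `1` with `2` and `3` with `0`. -/
def Smoothing.mate : Smoothing → Fin 4 → Fin 4
  | .A => ![1, 0, 3, 2]
  | .B => ![3, 2, 1, 0]

namespace LinkDiagram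

/-- The diagram is connected (and nonempty). -/
def Connected (D : LinkDiagram) : Prop :=
  Nat.card D.Component + D.freeCircles = 1

/-- The writhe: a crossing is positive exactly when, up to reversing both strands, the under-strand
runs from `0` to `2` and the over-strand from `3` to `1`. -/
def writhe (D : LinkDiagram) : ℤ :=
  ∑ c, if D.out (c, 1) = D.out (c, 2) then 1 else -1

/-- Points of the diagram away from the crossings, up to sliding them along the diagram without
passing a crossing.  An edge is named by either of its two ends, other points lie on
free circles.  These are also the points of (the circles of) any state away from crossing arcs. -/
abbrev Point (D : LinkDiagram) : Type := D.End ⊕ Fin D.freeCircles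

/-- A Kauffman state: a choice of smoothing at each crossing. -/
abbrev State (D : LinkDiagram) : Type := Fin D.crossings → Smoothing

namespace State

variable {D : LinkDiagram}

/-- Elementary adjacency of points on a state circle: along an edge, or along one of the two
strands of a smoothed crossing. -/
inductive CircleStep (x : D.State) : D.Point → D.Point → Prop
  | edge (e : D.End) : CircleStep x (Sum.inl e) (Sum.inl (D.edge e))
  | strand (c : Fin D.crossings) (k : Fin 4) :
      CircleStep x (Sum.inl (c, k)) (Sum.inl (c, (x c).mate k))

/-- The state circles. -/
def Circle (x : D.State) : Type := Quot x.CircleStep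

instance (x : D.State) : Finite x.Circle :=
  Finite.of_surjective (Quot.mk x.CircleStep) Quot.mk_surjective

/-- The state circle through a point. -/
def circleAt (x : D.State) (p : D.Point) : x.Circle := Quot.mk _ p

/-- The state circle at one end of the crossing arc at `c` (for either smoothing, the two strands at
`c` contain the edge-ends `0` and `2`, respectively). -/
def end₀ (x : D.State) (c : Fin D.crossings) : x.Circle := x.circleAt (Sum.inl (c, 0))

/-- The state circle at the other end of the crossing arc at `c`. -/
def end₂ (x : D.State) (c : Fin D.crossings) : x.Circle := x.circleAt (Sum.inl (c, 2))

/-- The crossing arc at `c` as an edge of the state graph. -/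
def arc (x : D.State) (c : Fin D.crossings) : Sym2 x.Circle := s(x.end₀ c, x.end₂ c)

/-- A state is adequate if each crossing arc joins distinct state circles. -/
def Adequate (x : D.State) : Prop := ∀ c, x.end₀ c ≠ x.end₂ c

/-- The adjacency structure of the state graph: its vertices are the state circles, and two
distinct circles are adjacent when some crossing arc joins them. -/
def stateGraph (x : D.State) : SimpleGraph x.Circle := SimpleGraph.fromEdgeSet (Set.range x.arc)

/-- The state graph with the vertex `v` deleted. -/
abbrev deleteCircle (x : D.State) (v : x.Circle) : SimpleGraph ({v}ᶜ : Set x.Circle) :=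
  x.stateGraph.induce {v}ᶜ

/-- `v` is a cut vertex of the state graph: deleting it disconnects some connected component. -/
def IsCutVertex (x : D.State) (v : x.Circle) : Prop :=
  ∃ u w : ({v}ᶜ : Set x.Circle),
    x.stateGraph.Reachable u w ∧ ¬ (x.deleteCircle v).Reachable u w

/-- Two crossing arcs still share an end after the state graph has been cut at all its cut vertices.
At a vertex that is not a cut vertex, any two incident edges do; cutting at a cut vertex `v`
keeps together those edges at `v` whose other ends lie in one component of the graph without `v`. -/
def BlockStep (x : D.State) (c c' : Fin D.crossings) : Prop :=
  ∃ v, v ∈ x.arc c ∧ v ∈ x.arc c' ∧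
    (¬ x.IsCutVertex v ∨
      ∃ u w : ({v}ᶜ : Set x.Circle),
        (u : x.Circle) ∈ x.arc c ∧ (w : x.Circle) ∈ x.arc c' ∧ (x.deleteCircle v).Reachable u w)

/-- Two crossing arcs belong to the same block. -/
def SameBlock (x : D.State) : Fin D.crossings → Fin D.crossings → Prop :=
  Relation.EqvGen x.BlockStep

/-- A state is homogeneous if no block contains both `A`- and `B`-type crossing arcs. -/
def Homogeneous (x : D.State) : Prop := ∀ c c', x.SameBlock c c' → x c = x c'

/-- A state is homogeneously adequate if it is both adequate and homogeneous. -/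
def HomogeneouslyAdequate (x : D.State) : Prop := x.Adequate ∧ x.Homogeneous

/-- The state circles of `x_A` (for `a = A`) or of `x_B` (for `a = B`): those incident to a crossing
arc of type `a`. -/
def circlesOf (x : D.State) (a : Smoothing) : Set x.Circle :=
  {u | ∃ c, x c = a ∧ u ∈ x.arc c}

/-- The adjacency structure of the graph of `x_A` or `x_B`. -/
def typeGraph (x : D.State) (a : Smoothing) : SimpleGraph (x.circlesOf a) :=
  (SimpleGraph.fromEdgeSet (x.arc '' {c | x c = a})).induce (x.circlesOf a)

/-- The `A`-zones or `B`-zones: the connected components of `x_A` or `x_B`. -/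
abbrev Zone (x : D.State) (a : Smoothing) : Type := (x.typeGraph a).ConnectedComponent

/-- The graph of `x_A` is bipartite: the state circles can be coloured with two colours so that each
`A`-type crossing arc joins circles of different colours.  (Colours of circles outside `x_A` are
irrelevant.) -/
def BipartiteA (x : D.State) : Prop :=
  ∃ f : x.Circle → Bool, ∀ c, x c = .A → f (x.end₀ c) ≠ f (x.end₂ c)

/-- `σ_x`, the number of `A`-smoothings minus the number of `B`-smoothings. -/
def sigma (x : D.State) : ℤ := ∑ c, if x c = .A then 1 else -1

/-- The homological grading `i_x = (w_D - σ_x) / 2`. -/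
def iDeg (x : D.State) : ℤ := (D.writhe - x.sigma) / 2

/-- The division in the definition of `i_x` is exact. -/
theorem two_mul_iDeg (x : D.State) : 2 * x.iDeg = D.writhe - x.sigma := by
  unfold iDeg writhe sigma
  refine Int.mul_ediv_cancel' ?_
  rw [← Finset.sum_sub_distrib]
  refine Finset.dvd_sum fun c _ => ?_
  split_ifs <;> norm_num

/-- The integer `j_x` of a state of a connected diagram. -/
def jDeg (x : D.State) : ℤ :=
  D.writhe + x.iDeg + (x.circlesOf .B).ncard - (x.circlesOf .A).ncard
    + Nat.card (x.Zone .A) - Nat.card (x.Zone .B)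

/-- An enhancement of the state `x`: a label on each state circle, `true` standing for the label
`1` (that is, for `q`) and `false` for the label `0` (that is, for `1 = q ^ 0`). -/
abbrev Enhancement (x : D.State) : Type := x.Circle → Bool

namespace Enhancement

variable {x : D.State}

/-- `τ_X`, the number of circles labelled `1` minus the number of circles labelled `0`. -/
def tau (X : x.Enhancement) : ℤ :=
  ({u | X u = true} : Set x.Circle).ncard - ({u | X u = false} : Set x.Circle).ncard

/-- The grading `j_X = w_D + i_x - τ_X`. -/
def jDeg (X : x.Enhancement) : ℤ := D.writhe + x.iDeg - X.tau

/-- The elementary move generating `A`-equivalence: interchange the labels `0` and `1` on the two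
state circles joined by an `A`-type crossing arc, where these labels are different. -/
def AMove (X Y : x.Enhancement) : Prop :=
  ∃ c, x c = .A ∧ X (x.end₀ c) ≠ X (x.end₂ c) ∧
    Y (x.end₀ c) = X (x.end₂ c) ∧ Y (x.end₂ c) = X (x.end₀ c) ∧
    ∀ u, u ≠ x.end₀ c → u ≠ x.end₂ c → Y u = X u

/-- The equivalence relation `∼_A` on enhancements. -/
def AEquiv : x.Enhancement → x.Enhancement → Prop := Relation.EqvGen AMove

/-- `ASteps k X Y`: a sequence of `k` elementary moves takes `X` to `Y`. -/
inductive ASteps : ℕ → x.Enhancement → x.Enhancement → Prop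
  | refl (X : x.Enhancement) : ASteps 0 X X
  | step {k : ℕ} {X Y Z : x.Enhancement} : ASteps k X Y → AMove Y Z → ASteps (k + 1) X Z

open Classical in
/-- `sgn (X → Y)` for `X ∼_A Y`: `1` if an even number of elementary moves takes `X` to `Y`,
and `-1` if an odd number does.  (The parity is determined by `X` and `Y` when all zones of
type `A` which are not bipartite are labelled `1` throughout, in particular when all of them are
bipartite.) -/
def sgn (X Y : x.Enhancement) : ℤ := if ∃ k, Even k ∧ ASteps k X Y then 1 else -1

end Enhancement

end State

/-- Enhanced states of a diagram. -/
abbrev EnhancedState (D : LinkDiagram) : Type := Σ x : D.State, x.Enhancement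

namespace EnhancedState

instance (D : LinkDiagram) : Fintype D.EnhancedState := Fintype.ofFinite _

variable {D : LinkDiagram}

/-- The label of the state circle through a point. -/
def labelAt (X : D.EnhancedState) (p : D.Point) : Bool := X.2 (X.1.circleAt p)

/-- `Y` is one of the terms of `d_c X`: the state of `Y` arises from that of `X` by changing the
smoothing at `c` from `A` to `B`, labels are unchanged on circles which do not meet `c`, and at `c`
the labels obey the incidence rules `q ⊗ q ↦ 0`, `1 ⊗ q, q ⊗ 1 ↦ q`, `1 ⊗ 1 ↦ 1` (two circles merge)
and `q ↦ q ⊗ q`, `1 ↦ q ⊗ 1 + 1 ⊗ q` (a circle splits). -/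
def Incident (c : Fin D.crossings) (X Y : D.EnhancedState) : Prop :=
  X.1 c = .A ∧ Y.1 = Function.update X.1 c .B ∧
  (∀ p, X.1.circleAt p ≠ X.1.end₀ c → X.1.circleAt p ≠ X.1.end₂ c → Y.labelAt p = X.labelAt p) ∧
  ((X.1.end₀ c ≠ X.1.end₂ c ∧ Y.1.end₀ c = Y.1.end₂ c ∧
      ((X.2 (X.1.end₀ c) = false ∧ X.2 (X.1.end₂ c) = true ∧ Y.2 (Y.1.end₀ c) = true) ∨
       (X.2 (X.1.end₀ c) = true ∧ X.2 (X.1.end₂ c) = false ∧ Y.2 (Y.1.end₀ c) = true) ∨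
       (X.2 (X.1.end₀ c) = false ∧ X.2 (X.1.end₂ c) = false ∧ Y.2 (Y.1.end₀ c) = false))) ∨
   (X.1.end₀ c = X.1.end₂ c ∧ Y.1.end₀ c ≠ Y.1.end₂ c ∧
      ((X.2 (X.1.end₀ c) = true ∧ Y.2 (Y.1.end₀ c) = true ∧ Y.2 (Y.1.end₂ c) = true) ∨
       (X.2 (X.1.end₀ c) = false ∧ Y.2 (Y.1.end₀ c) = true ∧ Y.2 (Y.1.end₂ c) = false) ∨
       (X.2 (X.1.end₀ c) = false ∧ Y.2 (Y.1.end₀ c) = false ∧ Y.2 (Y.1.end₂ c) = true))))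

end EnhancedState

/-- The Khovanov chain module `C_R(D)`, free on the enhanced states. -/
abbrev Chain (R : Type) [Ring R] (D : LinkDiagram) : Type := D.EnhancedState →₀ R

open Classical in
/-- `d_c X` for an enhanced state `X`. -/
def dAt (R : Type) [Ring R] {D : LinkDiagram} (c : Fin D.crossings) (X : D.EnhancedState) :
    Chain R D :=
  ∑ Y : D.EnhancedState, if X.Incident c Y then Finsupp.single Y 1 else 0

/-- The number of crossings before `c` at which the state has an `A`-smoothing. -/
def countABefore {D : LinkDiagram} (x : D.State) (c : Fin D.crossings) : ℕ :=
  (Finset.univ.filter fun s => s < c ∧ x s = .A).card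

/-- The differential, extended linearly from `d X = ∑ c, (-1) ^ (countABefore X c) • d_c X`. -/
def d (R : Type) [Ring R] (D : LinkDiagram) : Chain R D →ₗ[R] Chain R D :=
  Finsupp.linearCombination R fun X : D.EnhancedState =>
    ∑ c, (-1 : R) ^ countABefore X.1 c • dAt R c X

/-- Cycles modulo boundaries of an endomorphism `f` (used for `f ∘ f = 0`). -/
abbrev Homology {R M : Type} [Ring R] [AddCommGroup M] [Module R M] (f : M →ₗ[R] M) : Type :=
  LinearMap.ker f ⧸ (LinearMap.range f).comap (LinearMap.ker f).subtype

/-- The homology class of a cycle. -/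
def homologyClass {R M : Type} [Ring R] [AddCommGroup M] [Module R M] (f : M →ₗ[R] M)
    (z : LinearMap.ker f) : Homology f :=
  Submodule.Quotient.mk z

/-- Khovanov homology of the diagram. -/
abbrev Kh (R : Type) [Ring R] (D : LinkDiagram) : Type := Homology (d R D)

/-- The chain `z` is a cycle and represents a nonzero class in Khovanov homology. -/
def RepresentsNonzero (R : Type) [Ring R] {D : LinkDiagram} (z : Chain R D) : Prop :=
  ∃ hz : z ∈ LinearMap.ker (d R D), (homologyClass (d R D) ⟨z, hz⟩ : Kh R D) ≠ 0

/-- `C_R^{i,j}(x)`, spanned by the enhancements of the state `x` in bigrading `(i, j)`. -/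
def State.chains (R : Type) [Ring R] {D : LinkDiagram} (x : D.State) (i j : ℤ) :
    Submodule R (Chain R D) :=
  Submodule.span R {z | ∃ X : x.Enhancement, x.iDeg = i ∧ X.jDeg = j ∧
    z = Finsupp.single (⟨x, X⟩ : D.EnhancedState) 1}

namespace State.Enhancement

variable {D : LinkDiagram} {x : D.State}

instance : Fintype x.Enhancement := Fintype.ofFinite _

open Classical in
/-- The `A`-trace over the field with two elements, the sum of all `Y ∼_A X`. -/
def trF₂ (X : x.Enhancement) : Chain (ZMod 2) D :=
  ∑ Y : x.Enhancement with X.AEquiv Y, Finsupp.single (⟨x, Y⟩ : D.EnhancedState) 1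

open Classical in
/-- The `A`-trace over the integers, the sum of `sgn (X → Y) Y` over all `Y ∼_A X`. -/
def trℤ (X : x.Enhancement) : Chain ℤ D :=
  ∑ Y : x.Enhancement with X.AEquiv Y, Finsupp.single (⟨x, Y⟩ : D.EnhancedState) (X.sgn Y)

end State.Enhancement

end LinkDiagram

end

/-!
Let `Γ` be the bipartite graph whose vertices are the components of the graphs of the `A`-type and
of the `B`-type arcs (on all state circles) and whose edges are the state circles. For a
homogeneously adequate state `Γ` is a forest, because its blocks are monochromatic. Here this is
used in the following form. Choose a root circle in each component of the state graph, and let the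
height of a circle be its distance to the root. Then all arcs from a circle down to lower circles
have the same type (`isLocalMin_or`), and each component of the graph of one type has a strictly
lowest circle, which is its only local minimum (`IsLocalMin.height_lt`).

Label a circle `0` if arcs of type `B` lead down from it, and `1` otherwise; the root at `p` may
carry either label. In such a *rooted* enhancement `X` each component for type `A` has at most one
label `0`, and each component for type `B` at most one label `1`. Counting local minima gives the
value of `τ_X` and hence `j_x` (`tau_rooted`, `jDeg_eq_of_connected`).

* The `A`-trace of `X` is a cycle (`d_sum_single_eq_zero`): two labels `0` never meet at an `A`-type
  arc, two labels `1` merge to zero, and the terms with different labels at the arc cancel against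
  those with the labels exchanged. Over `ℤ` this uses that each move changes the parity of
  the number of circles with label `0` in one colour class of the bipartition (`AEquiv.sgn_eq`).
* It is not a boundary (`IsRooted.representsNonzero`). Let `S` be the set of enhancements with as many
  labels `1` as `X` in each component for type `B`. The sum modulo `2` of the coefficients in `S`
  vanishes on boundaries (`coeffSum_d`), since a splitting circle produces `q ⊗ 1` together with
  `1 ⊗ q`, and `q ⊗ q` never occurs in `S`. But `X` is the only member of `S` that is `A`-equivalent to
  `X`: an enhancement is determined by its counts of labels `0` and `1` in the components for type
  `A` and `B`, respectively, as one sees at the highest circle where two enhancements differ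
  (`eq_of_forall_ncard_labelled_eq`).

The functional takes values in `ZMod 2` for every coefficient ring, so the argument over `ℤ` is the
same as over the field with two elements. Planarity of the diagram plays no role.
-/

namespace LinkDiagram

/-! ### Heights in graphs with monochromatic blocks -/

section RootedGraph

variable {V : Type*} {G : SimpleGraph V} {H : Smoothing → SimpleGraph V}
  {r : G.ConnectedComponent → V}

theorem exists_adj_dist_lt {v s : V} (hvs : G.Reachable v s) (hne : v ≠ s) :
    ∃ w, G.Adj v w ∧ G.dist w s < G.dist v s := by
  obtain ⟨p, hp⟩ := hvs.exists_walk_length_eq_dist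
  cases p with
  | nil => exact absurd rfl hne
  | cons hadj q =>
    refine ⟨_, hadj, lt_of_le_of_lt (SimpleGraph.dist_le q) ?_⟩
    rw [← hp, SimpleGraph.Walk.length_cons]
    exact Nat.lt_succ_self _

/-- A geodesic from `u` to `s` cannot pass through a vertex `v ≠ u` that is at least as far from
`s` as `u` is. -/
theorem reachable_induce_compl_of_dist_le {u v s : V} (hus : G.Reachable u s) (huv : u ≠ v)
    (hle : G.dist u s ≤ G.dist v s) (hsv : s ≠ v) :
    (G.induce {v}ᶜ).Reachable ⟨u, huv⟩ ⟨s, hsv⟩ := by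
  classical
  obtain ⟨p, hp⟩ := hus.exists_walk_length_eq_dist
  refine ⟨p.induce {v}ᶜ fun w hw hwv => ?_⟩
  obtain rfl : w = v := hwv
  have h1 := SimpleGraph.dist_le (p.dropUntil w hw)
  have h2 := congrArg SimpleGraph.Walk.length (p.take_spec hw)
  rw [SimpleGraph.Walk.length_append] at h2
  have h3 : (p.takeUntil w hw).length ≠ 0 := fun h0 =>
    huv (SimpleGraph.Walk.eq_of_length_eq_zero h0)
  omega

/-- The first edge of a path from `v` to `u` leads to a vertex that is still joined to `u` after
deletion of `v`. -/
theorem exists_adj_reachable_induce_compl {K : SimpleGraph V} (hK : K ≤ G) {u v : V}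
    (hvu : K.Reachable v u) (huv : u ≠ v) :
    ∃ (w : V) (hw : w ≠ v), K.Adj v w ∧ (G.induce {v}ᶜ).Reachable ⟨w, hw⟩ ⟨u, huv⟩ := by
  obtain ⟨p, hp⟩ := hvu.exists_isPath
  cases p with
  | nil => exact absurd rfl huv
  | cons hadj q =>
    refine ⟨_, hadj.ne', hadj, ?_⟩
    rw [SimpleGraph.Walk.cons_isPath_iff] at hp
    refine ⟨(q.mapLe hK).induce {v}ᶜ fun w hw hwv => ?_⟩
    obtain rfl : w = v := hwv
    rw [SimpleGraph.Walk.support_mapLe_eq_support] at hw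
    exact hp.2 hw

/-- The graph `G` is the union of the graphs `H a`, and two edges at a vertex `v` have the same
type if their other ends are joined in `G` without `v`; that is, the blocks of `G` are
monochromatic. -/
structure MonochromaticBlocks (G : SimpleGraph V) (H : Smoothing → SimpleGraph V) : Prop where
  adj_iff : ∀ u v, G.Adj u v ↔ ∃ a, (H a).Adj u v
  eq_of_reachable : ∀ (v : V) (u w : ({v}ᶜ : Set V)) (a b : Smoothing), (H a).Adj v u →
    (H b).Adj v w → (G.induce {v}ᶜ).Reachable u w → a = b

/-- The distance of a vertex to the chosen root of its component. -/
noncomputable def height (r : G.ConnectedComponent → V) (u : V) : ℕ :=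
  G.dist u (r (G.connectedComponentMk u))

/-- No neighbour of `v` in the graph `K` has smaller height. -/
def IsLocalMin (K : SimpleGraph V) (h : V → ℕ) (v : V) : Prop := ∀ w, K.Adj v w → h v ≤ h w

theorem MonochromaticBlocks.le (hG : MonochromaticBlocks G H) (a : Smoothing) : H a ≤ G :=
  fun u v h => (hG.adj_iff u v).2 ⟨a, h⟩

theorem reachable_root (hr : ∀ C, G.connectedComponentMk (r C) = C) (u : V) :
    G.Reachable u (r (G.connectedComponentMk u)) :=
  (SimpleGraph.ConnectedComponent.exact (hr _)).symm

theorem exists_root (u : V) : ∃ r : G.ConnectedComponent → V,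
    (∀ C, G.connectedComponentMk (r C) = C) ∧ r (G.connectedComponentMk u) = u := by
  classical
  choose r hr using fun C : G.ConnectedComponent => C.exists_rep
  refine ⟨Function.update r (G.connectedComponentMk u) u, fun C => ?_, Function.update_self ..⟩
  by_cases hC : C = G.connectedComponentMk u
  · rw [hC, Function.update_self]
  · rw [Function.update_of_ne hC]
    exact hr C

/-- Within a component of `H a` the height has a strict minimum at every local minimum. Otherwise
let `v` be a local minimum and `u` another vertex of the component with smaller or equal height.
Without `v`, both the parent of `v` and the neighbour of `v` on an `H a`-path to `u` are joined to
the root, so the edge from `v` to its parent belongs to `H a`. -/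
theorem IsLocalMin.height_lt (hG : MonochromaticBlocks G H)
    (hr : ∀ C, G.connectedComponentMk (r C) = C) {a : Smoothing} {v : V}
    (hv : IsLocalMin (H a) (height r) v) {u : V} (hvu : (H a).Reachable v u) (huv : u ≠ v) :
    height r v < height r u := by
  by_contra! hle
  have hGvu : G.Reachable v u := hvu.mono (hG.le a)
  have hrt := SimpleGraph.ConnectedComponent.sound hGvu
  have hvs := reachable_root hr v
  have hus := reachable_root hr u
  have hw_root : ∀ w, G.Adj v w →
      r (G.connectedComponentMk w) = r (G.connectedComponentMk v) := fun w hw => by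
    rw [SimpleGraph.ConnectedComponent.sound hw.reachable]
  unfold height at hle
  rw [← hrt] at hle hus
  generalize hs : r (G.connectedComponentMk v) = s at *
  have hsv : s ≠ v := by
    rintro rfl
    rw [SimpleGraph.dist_self, Nat.le_zero, hus.dist_eq_zero_iff] at hle
    exact huv hle
  obtain ⟨w, hw, hadj, hwu⟩ := exists_adj_reachable_induce_compl (hG.le a) hvu huv
  obtain ⟨w', hadj', hlt⟩ := exists_adj_dist_lt hvs hsv.symm
  obtain ⟨b, hb⟩ := (hG.adj_iff v w').1 hadj'
  have hus' := reachable_induce_compl_of_dist_le hus huv hle hsv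
  have hws' := reachable_induce_compl_of_dist_le (hadj'.symm.reachable.trans hvs) hadj'.ne'
    hlt.le hsv
  have hab := hG.eq_of_reachable v ⟨w, hw⟩ ⟨w', hadj'.ne'⟩ a b hadj hb
    (hwu.trans (hus'.trans hws'.symm))
  subst hab
  have := hv w' hb
  unfold height at this
  rw [hw_root w' hadj', hs] at this
  omega

/-- All edges from a vertex `v` to vertices of smaller height have the same type, since the other ends
of two such edges are both joined to the root without `v`. -/
theorem isLocalMin_or (hG : MonochromaticBlocks G H)
    (hr : ∀ C, G.connectedComponentMk (r C) = C) (v : V) :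
    IsLocalMin (H .A) (height r) v ∨ IsLocalMin (H .B) (height r) v := by
  by_contra hcon
  simp only [IsLocalMin, not_or, not_forall, not_le] at hcon
  obtain ⟨⟨w, hw, hlt⟩, ⟨w', hw', hlt'⟩⟩ := hcon
  have key : ∀ u, G.Adj v u → height r u < height r v →
      r (G.connectedComponentMk v) ≠ v ∧ ∀ hsv hu,
      (G.induce {v}ᶜ).Reachable ⟨u, hu⟩ ⟨r (G.connectedComponentMk v), hsv⟩ := by
    intro u hu hlt
    unfold height at hlt
    rw [← SimpleGraph.ConnectedComponent.sound hu.reachable] at hlt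
    refine ⟨fun h => ?_, fun hsv hu' => ?_⟩
    · rw [h, SimpleGraph.dist_self] at hlt
      exact absurd hlt (Nat.not_lt_zero _)
    · exact reachable_induce_compl_of_dist_le (hu.symm.reachable.trans (reachable_root hr v)) hu'
        hlt.le hsv
  have hGw := hG.le _ hw
  have hGw' := hG.le _ hw'
  obtain ⟨hsv, h1⟩ := key w hGw hlt
  obtain ⟨-, h2⟩ := key w' hGw' hlt'
  have := hG.eq_of_reachable v ⟨w, hGw.ne'⟩ ⟨w', hGw'.ne'⟩ _ _ hw hw'
    ((h1 hsv _).trans (h2 hsv _).symm)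
  exact absurd this (by decide)

theorem isLocalMin_and_iff (hG : MonochromaticBlocks G H)
    (hr : ∀ C, G.connectedComponentMk (r C) = C) (v : V) :
    IsLocalMin (H .A) (height r) v ∧ IsLocalMin (H .B) (height r) v ↔
      r (G.connectedComponentMk v) = v := by
  constructor
  · rintro ⟨hA, hB⟩
    by_contra hne
    obtain ⟨w, hadj, hlt⟩ := exists_adj_dist_lt (reachable_root hr v) (Ne.symm hne)
    obtain ⟨b, hb⟩ := (hG.adj_iff v w).1 hadj
    have hle : height r v ≤ height r w := by cases b <;> [exact hA w hb; exact hB w hb]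
    unfold height at hle
    rw [← SimpleGraph.ConnectedComponent.sound hadj.reachable] at hle
    omega
  · intro h
    have : height r v = 0 := by rw [height, h, SimpleGraph.dist_self]
    exact ⟨fun w _ => this ▸ Nat.zero_le _, fun w _ => this ▸ Nat.zero_le _⟩

theorem ncard_root (hr : ∀ C, G.connectedComponentMk (r C) = C) :
    {v | r (G.connectedComponentMk v) = v}.ncard = Nat.card G.ConnectedComponent := by
  rw [← Nat.card_coe_set_eq]
  refine Nat.card_congr (Equiv.ofBijective (fun v => G.connectedComponentMk v.1) ⟨?_, ?_⟩)
  · rintro ⟨v, hv⟩ ⟨w, hw⟩ hvw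
    have hv : r (G.connectedComponentMk v) = v := hv
    have hw : r (G.connectedComponentMk w) = w := hw
    exact Subtype.ext (hv.symm.trans ((congrArg r hvw).trans hw))
  · exact fun C => ⟨⟨r C, congrArg r (hr C)⟩, hr C⟩

variable [Finite V]

theorem exists_isLocalMin_reachable (K : SimpleGraph V) (h : V → ℕ) (u : V) :
    ∃ v, K.Reachable v u ∧ IsLocalMin K h v := by
  obtain ⟨v, hv, hmin⟩ := Set.exists_min_image {v | K.Reachable v u} h (Set.toFinite _)
    ⟨u, SimpleGraph.Reachable.refl u⟩
  exact ⟨v, hv, fun w hw => hmin w (hw.symm.reachable.trans hv)⟩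

theorem ncard_isLocalMin (hG : MonochromaticBlocks G H)
    (hr : ∀ C, G.connectedComponentMk (r C) = C) (a : Smoothing) :
    {v | IsLocalMin (H a) (height r) v}.ncard = Nat.card (H a).ConnectedComponent := by
  rw [← Nat.card_coe_set_eq]
  refine Nat.card_congr (Equiv.ofBijective (fun v => (H a).connectedComponentMk v.1) ⟨?_, ?_⟩)
  · rintro ⟨v, hv⟩ ⟨w, hw⟩ hvw
    have hvw : (H a).Reachable v w := SimpleGraph.ConnectedComponent.exact hvw
    by_contra hne
    have hne : w ≠ v := fun h => hne (Subtype.ext h.symm)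
    exact lt_asymm (IsLocalMin.height_lt hG hr hv hvw hne)
      (IsLocalMin.height_lt hG hr hw hvw.symm hne.symm)
  · intro C
    induction C using SimpleGraph.ConnectedComponent.ind with
    | _ u =>
      obtain ⟨v, hvu, hv⟩ := exists_isLocalMin_reachable (H a) (height r) u
      exact ⟨⟨v, hv⟩, SimpleGraph.ConnectedComponent.sound hvu⟩

/-- Every vertex other than a root is a local minimum for exactly one of the two types. -/
theorem ncard_not_isLocalMin_B (hG : MonochromaticBlocks G H)
    (hr : ∀ C, G.connectedComponentMk (r C) = C) :
    ({v | ¬ IsLocalMin (H .B) (height r) v}.ncard : ℤ) =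
      Nat.card (H .A).ConnectedComponent - Nat.card G.ConnectedComponent := by
  rw [← ncard_isLocalMin hG hr, ← ncard_root hr]
  have : {v | IsLocalMin (H .A) (height r) v} =
      {v | ¬ IsLocalMin (H .B) (height r) v} ∪ {v | r (G.connectedComponentMk v) = v} := by
    ext v
    have h1 := isLocalMin_or hG hr v
    have h2 := isLocalMin_and_iff hG hr v
    simp only [Set.mem_ofPred_eq, Set.mem_union]
    tauto
  rw [this, Set.ncard_union_eq]
  · push_cast
    ring
  · rw [Set.disjoint_left]
    exact fun v hv hv' => hv ((isLocalMin_and_iff hG hr v).2 hv').2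

end RootedGraph

/-! ### Exchanging labels along a crossing arc -/

namespace State.Enhancement

variable {D : LinkDiagram} {x : D.State}

open Classical in
/-- The enhancement with the labels at the two ends of the crossing arc at `c` interchanged. -/
noncomputable def exchange (X : x.Enhancement) (c : Fin D.crossings) : x.Enhancement :=
  X ∘ Equiv.swap (x.end₀ c) (x.end₂ c)

@[simp]
theorem exchange_end₀ (X : x.Enhancement) (c : Fin D.crossings) :
    X.exchange c (x.end₀ c) = X (x.end₂ c) := by simp [exchange]

@[simp]
theorem exchange_end₂ (X : x.Enhancement) (c : Fin D.crossings) :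
    X.exchange c (x.end₂ c) = X (x.end₀ c) := by simp [exchange]

theorem exchange_of_ne (X : x.Enhancement) {c : Fin D.crossings} {u : x.Circle}
    (h₀ : u ≠ x.end₀ c) (h₂ : u ≠ x.end₂ c) : X.exchange c u = X u := by
  classical exact congrArg X (Equiv.swap_apply_of_ne_of_ne h₀ h₂)

@[simp]
theorem exchange_exchange (X : x.Enhancement) (c : Fin D.crossings) :
    (X.exchange c).exchange c = X := by
  classical
  funext u
  simp [exchange]

theorem exchange_eq_self (X : x.Enhancement) {c : Fin D.crossings}
    (h : X (x.end₀ c) = X (x.end₂ c)) : X.exchange c = X := by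
  funext u
  by_cases h₀ : u = x.end₀ c
  · rw [h₀, exchange_end₀, h]
  by_cases h₂ : u = x.end₂ c
  · rw [h₂, exchange_end₂, h]
  exact exchange_of_ne X h₀ h₂

theorem aMove_iff {X Y : x.Enhancement} :
    X.AMove Y ↔ ∃ c, x c = .A ∧ X (x.end₀ c) ≠ X (x.end₂ c) ∧ Y = X.exchange c := by
  constructor
  · rintro ⟨c, hc, hne, h₀, h₂, hu⟩
    refine ⟨c, hc, hne, funext fun u => ?_⟩
    by_cases hu₀ : u = x.end₀ c
    · rw [hu₀, h₀, exchange_end₀]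
    by_cases hu₂ : u = x.end₂ c
    · rw [hu₂, h₂, exchange_end₂]
    rw [hu u hu₀ hu₂, exchange_of_ne X hu₀ hu₂]
  · rintro ⟨c, hc, hne, rfl⟩
    exact ⟨c, hc, hne, by simp, by simp, fun u h₀ h₂ => exchange_of_ne X h₀ h₂⟩

theorem aEquiv_exchange (X : x.Enhancement) {c : Fin D.crossings} (hc : x c = .A) :
    X.AEquiv (X.exchange c) := by
  by_cases h : X (x.end₀ c) = X (x.end₂ c)
  · rw [exchange_eq_self X h]
    exact Relation.EqvGen.refl _
  · exact Relation.EqvGen.rel _ _ (aMove_iff.2 ⟨c, hc, h, rfl⟩)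

theorem aEquiv_exchange_iff (X Y : x.Enhancement) {c : Fin D.crossings} (hc : x c = .A) :
    X.AEquiv (Y.exchange c) ↔ X.AEquiv Y :=
  ⟨fun h => h.trans _ _ _ ((aEquiv_exchange Y hc).symm _ _),
    fun h => h.trans _ _ _ (aEquiv_exchange Y hc)⟩

/-- A quantity that is unchanged by exchanging the labels along `A`-type arcs is constant on
`A`-equivalence classes. -/
theorem AEquiv.eq_of_exchange {α : Type*} {F : x.Enhancement → α}
    (hF : ∀ (X : x.Enhancement) (c : Fin D.crossings), x c = .A → F (X.exchange c) = F X)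
    {X Y : x.Enhancement} (h : X.AEquiv Y) : F Y = F X := by
  induction h with
  | rel X Y h =>
    obtain ⟨c, hc, -, rfl⟩ := aMove_iff.1 h
    exact hF X c hc
  | refl => rfl
  | symm X Y _ ih => exact ih.symm
  | trans X Y Z _ _ ih₁ ih₂ => exact ih₂.trans ih₁

theorem tau_exchange (X : x.Enhancement) (c : Fin D.crossings) : (X.exchange c).tau = X.tau := by
  classical
  have key : ∀ b, ({u | X.exchange c u = b} : Set x.Circle).ncard =
      ({u | X u = b} : Set x.Circle).ncard := fun b =>
    Set.ncard_preimage_of_injective_subset_range (s := {u | X u = b})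
      (Equiv.swap (x.end₀ c) (x.end₂ c)).injective (by simp)
  rw [tau, tau, key, key]

theorem AEquiv.jDeg_eq {X Y : x.Enhancement} (h : X.AEquiv Y) : Y.jDeg = X.jDeg := by
  rw [jDeg, jDeg, h.eq_of_exchange fun X c _ => tau_exchange X c]

end State.Enhancement

/-! ### Cycles and boundaries -/

section Differential

open State.Enhancement

variable {D : LinkDiagram} {x : D.State}

/-- Both labellings `1 ⊗ q` and `q ⊗ 1` of two merging circles give `q`. -/
theorem EnhancedState.Incident.exchange_left {c : Fin D.crossings} {X : x.Enhancement}
    {W : D.EnhancedState} (hne : x.end₀ c ≠ x.end₂ c)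
    (h : EnhancedState.Incident c ⟨x, X⟩ W) : EnhancedState.Incident c ⟨x, X.exchange c⟩ W := by
  obtain ⟨hc, hW, hp, h⟩ := h
  refine ⟨hc, hW, fun p h₀ h₂ => ?_, ?_⟩
  · exact (hp p h₀ h₂).trans (exchange_of_ne X h₀ h₂).symm
  · obtain ⟨-, h', h⟩ | ⟨h, -⟩ := h
    · refine Or.inl ⟨hne, h', ?_⟩
      simp only [exchange_end₀, exchange_end₂]
      tauto
    · exact absurd h hne

theorem incident_exchange_left_iff {c : Fin D.crossings} {X : x.Enhancement}
    {W : D.EnhancedState} (hne : x.end₀ c ≠ x.end₂ c) :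
    EnhancedState.Incident c ⟨x, X.exchange c⟩ W ↔ EnhancedState.Incident c ⟨x, X⟩ W :=
  ⟨fun h => by simpa using h.exchange_left hne, fun h => h.exchange_left hne⟩

/-- If all four edge-ends at `c` lie on one circle of the state `y`, then resmoothing `c` refines
the partition of the points into circles. -/
theorem State.circleAt_eq_of_update {y : D.State} {c : Fin D.crossings} {a b : Smoothing}
    (hy : y c = a) (hends : y.end₀ c = y.end₂ c) {p p' : D.Point}
    (h : State.circleAt (Function.update y c b) p = State.circleAt (Function.update y c b) p') :
    y.circleAt p = y.circleAt p' := by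
  have hall : ∀ k, y.circleAt (Sum.inl (c, k)) = y.end₀ c := by
    have step : ∀ k, y.circleAt (Sum.inl (c, k)) = y.circleAt (Sum.inl (c, (y c).mate k)) :=
      fun k => Quot.sound (.strand c k)
    intro k
    have h1 := step 1
    have h3 := step 3
    have e0 : y.circleAt (Sum.inl (c, 0)) = y.end₀ c := rfl
    have e2 : y.circleAt (Sum.inl (c, 2)) = y.end₀ c := hends.symm
    cases a <;> rw [hy] at h1 h3 <;> fin_cases k <;>
      first
      | exact e0
      | exact e2
      | exact h1.trans e0
      | exact h1.trans e2
      | exact h3.trans e0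
      | exact h3.trans e2
  replace h := Quot.eqvGen_exact h
  induction h with
  | rel p p' h =>
    cases h with
    | edge e => exact Quot.sound (.edge e)
    | strand c' k =>
      by_cases hc : c' = c
      · subst hc
        rw [hall, hall]
      · rw [Function.update_of_ne hc]
        exact Quot.sound (.strand c' k)
  | refl => rfl
  | symm _ _ _ ih => exact ih.symm
  | trans _ _ _ _ _ ih₁ ih₂ => exact ih₁.trans ih₂

/-- The terms `q ⊗ 1` and `1 ⊗ q` at a splitting circle occur together. -/
theorem EnhancedState.Incident.exchange_right {c : Fin D.crossings} {W : D.EnhancedState}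
    {X : x.Enhancement} (hne : x.end₀ c ≠ x.end₂ c)
    (hX : ¬ (X (x.end₀ c) = true ∧ X (x.end₂ c) = true))
    (h : W.Incident c ⟨x, X⟩) : W.Incident c ⟨x, X.exchange c⟩ := by
  obtain ⟨hc, hW, hp, h⟩ := h
  obtain ⟨-, h, -⟩ | ⟨hends, -, h⟩ := h
  · exact absurd h hne
  refine ⟨hc, hW, fun p h₀ h₂ => ?_, Or.inr ⟨hends, hne, ?_⟩⟩
  · refine Eq.trans ?_ (hp p h₀ h₂)
    have hW : x = Function.update W.1 c .B := hW
    subst hW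
    refine exchange_of_ne X (fun h => ?_) (fun h => ?_)
    · exact h₀ (State.circleAt_eq_of_update hc hends h)
    · exact h₂ (State.circleAt_eq_of_update hc hends h)
  · simp only [exchange_end₀, exchange_end₂]
    simp only at h hX
    tauto

open Classical in
theorem dAt_apply (R : Type) [Ring R] (c : Fin D.crossings) (X Y : D.EnhancedState) :
    dAt R c X Y = if X.Incident c Y then 1 else 0 := by
  rw [dAt, Finsupp.finsetSum_apply, Finset.sum_eq_single Y]
  · split_ifs <;> simp
  · intro Z _ hZ
    split_ifs <;> simp [hZ]
  · exact fun h => absurd (Finset.mem_univ _) h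

/-- A chain on the enhancements of an adequate state is a cycle if its coefficients change sign
whenever different labels at the ends of an `A`-type arc are exchanged, and vanish on enhancements
with two labels `0` joined by such an arc. -/
theorem d_sum_single_eq_zero {R : Type} [Ring R] (hx : x.Adequate) {f : x.Enhancement → R}
    (h_zero : ∀ Y c, x c = .A → Y (x.end₀ c) = false → Y (x.end₂ c) = false → f Y = 0)
    (h_neg : ∀ Y c, x c = .A → Y (x.end₀ c) ≠ Y (x.end₂ c) →
      f (exchange Y c) = - f Y) :
    d R D (∑ Y, Finsupp.single (⟨x, Y⟩ : D.EnhancedState) (f Y)) = 0 := by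
  classical
  rw [map_sum]
  simp only [d, Finsupp.linearCombination_single, Finset.smul_sum]
  rw [Finset.sum_comm]
  refine Finset.sum_eq_zero fun c _ => Finsupp.ext fun W => ?_
  simp only [Finsupp.finsetSum_apply, Finsupp.smul_apply, dAt_apply, Finsupp.zero_apply]
  have incident_cases : ∀ Y : x.Enhancement, EnhancedState.Incident c ⟨x, Y⟩ W →
      f Y = 0 ∨ Y (x.end₀ c) ≠ Y (x.end₂ c) := by
    rintro Y ⟨hc, -, -, ⟨-, -, h⟩ | ⟨h, -⟩⟩
    · obtain ⟨h₀, h₂, -⟩ | ⟨h₀, h₂, -⟩ | ⟨h₀, h₂, -⟩ := h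
      · exact Or.inr (by simp only at h₀ h₂; rw [h₀, h₂]; decide)
      · exact Or.inr (by simp only at h₀ h₂; rw [h₀, h₂]; decide)
      · exact Or.inl (h_zero Y c hc h₀ h₂)
    · exact absurd h (hx c)
  refine Finset.sum_involution (fun Y _ => exchange Y c) ?_ ?_ (fun _ _ => Finset.mem_univ _)
    (fun Y _ => exchange_exchange Y c)
  · intro Y _
    rw [incident_exchange_left_iff (hx c)]
    split_ifs with hI
    · by_cases hne : Y (x.end₀ c) = Y (x.end₂ c)
      · have h0 := (incident_cases Y hI).resolve_right (not_not.2 hne)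
        rw [exchange_eq_self Y hne, h0]
        simp
      · rw [h_neg Y c hI.1 hne]
        simp
    · simp
  · intro Y _ hY hself
    split_ifs at hY with hI
    · obtain h0 | hne := incident_cases Y hI
      · simp [h0] at hY
      · exact hne (by conv_lhs => rw [← hself, exchange_end₀])
    · simp at hY

/-- The sum modulo `2` of the coefficients of a chain at the enhancements in `S`. -/
def coeffSum {R : Type} [Ring R] (ρ : R →+* ZMod 2) (S : Finset x.Enhancement)
    (z : Chain R D) : ZMod 2 :=
  ∑ Z ∈ S, ρ (z ⟨x, Z⟩)

/-- The functional `coeffSum` vanishes on boundaries if `S` is closed under exchanging labels along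
`B`-type arcs and has no element with two labels `1` joined by such an arc: the terms of a boundary
in `S` cancel in pairs `q ⊗ 1 + 1 ⊗ q`. -/
theorem coeffSum_d {R : Type} [Ring R] (ρ : R →+* ZMod 2) (hx : x.Adequate)
    {S : Finset x.Enhancement}
    (hS : ∀ Z ∈ S, ∀ c, x c = .B → ¬ (Z (x.end₀ c) = true ∧ Z (x.end₂ c) = true))
    (hS_exchange : ∀ Z ∈ S, ∀ c, x c = .B → exchange Z c ∈ S) (z : Chain R D) :
    coeffSum ρ S (d R D z) = 0 := by
  classical
  have key : ∀ (W : D.EnhancedState) (c : Fin D.crossings),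
      ∑ Z ∈ S, (if W.Incident c ⟨x, Z⟩ then (1 : ZMod 2) else 0) = 0 := by
    intro W c
    by_cases hc : x c = .B
    · refine Finset.sum_involution (fun Z _ => exchange Z c) ?_ ?_
        (fun Z hZ => hS_exchange Z hZ c hc) (fun Z _ => exchange_exchange Z c)
      · intro Z hZ
        have hiff : W.Incident c ⟨x, exchange Z c⟩ ↔ W.Incident c ⟨x, Z⟩ :=
          ⟨fun h => by
            simpa using h.exchange_right (hx c) (hS _ (hS_exchange Z hZ c hc) c hc),
            fun h => h.exchange_right (hx c) (hS Z hZ c hc)⟩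
        rw [hiff]
        split_ifs
        · decide
        · simp
      · intro Z hZ hne hself
        split_ifs at hne with hI
        · have hlab : Z (x.end₀ c) = Z (x.end₂ c) := by
            conv_lhs => rw [← hself, exchange_end₀]
          obtain ⟨-, -, -, ⟨-, h, -⟩ | ⟨-, -, h⟩⟩ := hI
          · exact hx c h
          · have := hS Z hZ c hc
            simp only at h
            rw [hlab] at h this
            cases hb : Z (x.end₂ c) <;> simp [hb] at h this
        · exact hne rfl
    · refine Finset.sum_eq_zero fun Z _ => if_neg fun hI => hc ?_
      have h := congrFun hI.2.1 c
      simpa using h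
  have hz : d R D z =
      ∑ W ∈ z.support, ∑ c, (z W * (-1 : R) ^ countABefore W.1 c) • dAt R c W := by
    rw [d, Finsupp.linearCombination_apply, Finsupp.sum]
    simp only [Finset.smul_sum, smul_smul]
  rw [coeffSum, hz]
  simp only [Finsupp.finsetSum_apply, Finsupp.smul_apply, dAt_apply, map_sum, smul_eq_mul, map_mul]
  rw [Finset.sum_comm]
  refine Finset.sum_eq_zero fun W _ => ?_
  rw [Finset.sum_comm]
  refine Finset.sum_eq_zero fun c _ => ?_
  rw [← Finset.mul_sum]
  refine mul_eq_zero_of_right _ (Eq.trans (Finset.sum_congr rfl fun Z _ => ?_) (key W c))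
  split_ifs <;> simp

theorem representsNonzero_of_notMem_range {R : Type} [Ring R] {z : Chain R D}
    (hz : d R D z = 0) (h : z ∉ LinearMap.range (d R D)) : RepresentsNonzero R z := by
  refine ⟨hz, fun h0 => h ?_⟩
  rw [homologyClass, Submodule.Quotient.mk_eq_zero] at h0
  exact h0

end Differential

/-! ### The graphs of the two types of arcs -/

namespace State

variable {D : LinkDiagram} (x : D.State)

/-- The graph on all state circles whose edges are the crossing arcs of type `a`. A circle that
meets no arc of type `a` is a component on its own. -/
def colorGraph (a : Smoothing) : SimpleGraph x.Circle :=
  SimpleGraph.fromEdgeSet (x.arc '' {c | x c = a})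

variable {x}

theorem colorGraph_adj {a : Smoothing} {u v : x.Circle} :
    (x.colorGraph a).Adj u v ↔ (∃ c, x c = a ∧ x.arc c = s(u, v)) ∧ u ≠ v := by
  simp [colorGraph, SimpleGraph.fromEdgeSet_adj]

theorem colorGraph_reachable_ends (c : Fin D.crossings) :
    (x.colorGraph (x c)).Reachable (x.end₀ c) (x.end₂ c) := by
  by_cases h : x.end₀ c = x.end₂ c
  · rw [h]
  · exact (colorGraph_adj.2 ⟨⟨c, rfl, rfl⟩, h⟩).reachable

theorem HomogeneouslyAdequate.monochromaticBlocks (hx : x.HomogeneouslyAdequate) :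
    MonochromaticBlocks x.stateGraph x.colorGraph where
  adj_iff u v := by
    simp only [colorGraph_adj, stateGraph, SimpleGraph.fromEdgeSet_adj, Set.mem_range]
    constructor
    · rintro ⟨⟨c, hc⟩, hne⟩
      exact ⟨x c, ⟨c, rfl, hc⟩, hne⟩
    · rintro ⟨a, ⟨c, -, hc⟩, hne⟩
      exact ⟨⟨c, hc⟩, hne⟩
  eq_of_reachable v u w a b hu hw h := by
    obtain ⟨⟨c, rfl, hc⟩, -⟩ := colorGraph_adj.1 hu
    obtain ⟨⟨c', rfl, hc'⟩, -⟩ := colorGraph_adj.1 hw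
    refine hx.2 c c' (Relation.EqvGen.rel _ _ ⟨v, ?_, ?_, Or.inr ⟨u, w, ?_, ?_, h⟩⟩) <;>
      simp [hc, hc']

/-! ### Zones and connected diagrams -/

section Zones

theorem mem_circlesOf_of_adj {a : Smoothing} {u v : x.Circle} (h : (x.colorGraph a).Adj u v) :
    u ∈ x.circlesOf a ∧ v ∈ x.circlesOf a := by
  obtain ⟨⟨c, hc, harc⟩, -⟩ := colorGraph_adj.1 h
  exact ⟨⟨c, hc, by simp [harc]⟩, ⟨c, hc, by simp [harc]⟩⟩

theorem eq_or_mem_circlesOf_of_reachable {a : Smoothing} {u v : x.Circle}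
    (h : (x.colorGraph a).Reachable u v) :
    u = v ∨ u ∈ x.circlesOf a ∧ v ∈ x.circlesOf a := by
  obtain ⟨p⟩ := h
  induction p with
  | nil => exact Or.inl rfl
  | cons hadj _ ih =>
    have := mem_circlesOf_of_adj hadj
    obtain rfl | ⟨-, h⟩ := ih
    · exact Or.inr this
    · exact Or.inr ⟨this.1, h⟩

/-- The components of `colorGraph a` are the zones of type `a` and the circles that meet no arc of
type `a`. -/
theorem card_colorGraph_connectedComponent (a : Smoothing) :
    Nat.card (x.colorGraph a).ConnectedComponent + (x.circlesOf a).ncard =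
      Nat.card (x.Zone a) + Nat.card x.Circle := by
  classical
  let F : x.Zone a ⊕ ((x.circlesOf a)ᶜ : Set x.Circle) → (x.colorGraph a).ConnectedComponent :=
    Sum.elim
      (SimpleGraph.ConnectedComponent.map
        (SimpleGraph.Embedding.induce (G := x.colorGraph a) (x.circlesOf a)).toHom)
      (fun u => (x.colorGraph a).connectedComponentMk u)
  have hF : Function.Bijective F := by
    constructor
    · rintro (C | u) (C' | v) h
      · induction C using SimpleGraph.ConnectedComponent.ind with | _ u
        induction C' using SimpleGraph.ConnectedComponent.ind with | _ v
        have h : (x.colorGraph a).Reachable u.1 v.1 := SimpleGraph.ConnectedComponent.exact h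
        obtain ⟨p⟩ := h
        refine congrArg Sum.inl (SimpleGraph.ConnectedComponent.sound ⟨p.induce _ fun w hw => ?_⟩)
        obtain rfl | h := eq_or_mem_circlesOf_of_reachable (p.takeUntil w hw).reachable
        · exact u.2
        · exact h.2
      · induction C using SimpleGraph.ConnectedComponent.ind with | _ u
        have h : (x.colorGraph a).Reachable u.1 v.1 := SimpleGraph.ConnectedComponent.exact h
        obtain h | h := eq_or_mem_circlesOf_of_reachable h
        · exact absurd (h ▸ u.2) v.2
        · exact absurd h.2 v.2
      · induction C' using SimpleGraph.ConnectedComponent.ind with | _ v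
        have h : (x.colorGraph a).Reachable u.1 v.1 := SimpleGraph.ConnectedComponent.exact h
        obtain h | h := eq_or_mem_circlesOf_of_reachable h
        · exact absurd (h ▸ v.2) u.2
        · exact absurd h.1 u.2
      · have h : (x.colorGraph a).Reachable u.1 v.1 := SimpleGraph.ConnectedComponent.exact h
        obtain h | h := eq_or_mem_circlesOf_of_reachable h
        · exact congrArg Sum.inr (Subtype.ext h)
        · exact absurd h.1 u.2
    · intro C
      induction C using SimpleGraph.ConnectedComponent.ind with | _ u
      by_cases hu : u ∈ x.circlesOf a
      · exact ⟨Sum.inl ((x.typeGraph a).connectedComponentMk ⟨u, hu⟩), rfl⟩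
      · exact ⟨Sum.inr ⟨u, hu⟩, rfl⟩
  rw [← Nat.card_congr (Equiv.ofBijective F hF), Nat.card_sum, Nat.card_coe_set_eq,
    ← Set.ncard_add_ncard_compl (x.circlesOf a)]
  ring

theorem Adequate.reachable_end₀ (hx : x.Adequate) (c : Fin D.crossings) (k : Fin 4) :
    x.stateGraph.Reachable (x.circleAt (Sum.inl (c, k))) (x.end₀ c) := by
  have h02 : x.stateGraph.Reachable (x.end₂ c) (x.end₀ c) :=
    SimpleGraph.Adj.reachable
      ((SimpleGraph.fromEdgeSet_adj _).2 ⟨⟨c, Sym2.eq_swap⟩, (hx c).symm⟩)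
  have step : x.circleAt (Sum.inl (c, k)) = x.circleAt (Sum.inl (c, (x c).mate k)) :=
    Quot.sound (.strand c k)
  have e0 : x.stateGraph.Reachable (x.circleAt (Sum.inl (c, 0))) (x.end₀ c) := .refl _
  cases h : x c <;> rw [h] at step <;> fin_cases k <;>
    first
    | exact e0
    | exact h02
    | (rw [step]; exact e0)
    | (rw [step]; exact h02)

theorem Adequate.card_connectedComponent_of_connected (hx : x.Adequate) (hD : D.Connected) :
    Nat.card x.stateGraph.ConnectedComponent = 1 := by
  have hfin : Finite D.Component := Finite.of_surjective (Quot.mk _) Quot.mk_surjective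
  have hreach : ∀ p p', x.stateGraph.Reachable (x.circleAt p) (x.circleAt p') := by
    unfold Connected at hD
    obtain ⟨hC, hf⟩ | ⟨hC, hf⟩ :
        (Nat.card D.Component = 1 ∧ D.freeCircles = 0) ∨
          (Nat.card D.Component = 0 ∧ D.freeCircles = 1) := by omega
    · have hsub := (Nat.card_eq_one_iff_unique.1 hC).1
      have hcc : ∀ c c', x.stateGraph.Reachable (x.end₀ c) (x.end₀ c') := by
        intro c c'
        have h := Quot.eqvGen_exact (hsub.elim (Quot.mk D.CrossingStep c) (Quot.mk _ c'))
        induction h with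
        | rel c c' h =>
          obtain ⟨k, rfl⟩ := h
          have hedge : x.circleAt (Sum.inl (c, k)) = x.circleAt (Sum.inl (D.edge (c, k))) :=
            Quot.sound (.edge _)
          refine (hx.reachable_end₀ c k).symm.trans ?_
          rw [hedge]
          exact hx.reachable_end₀ _ _
        | refl => exact .refl _
        | symm _ _ _ ih => exact ih.symm
        | trans _ _ _ _ _ ih₁ ih₂ => exact ih₁.trans ih₂
      rintro (⟨c, k⟩ | m) (⟨c', k'⟩ | m')
      · exact (hx.reachable_end₀ c k).trans ((hcc c c').trans (hx.reachable_end₀ c' k').symm)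
      all_goals first | exact (finCongr hf m').elim0 | exact (finCongr hf m).elim0
    · have hempty : IsEmpty D.Component := (Finite.card_eq_zero_iff).1 hC
      rintro (⟨c, k⟩ | m) (⟨c', k'⟩ | m')
      · exact hempty.elim (Quot.mk _ c)
      · exact hempty.elim (Quot.mk _ c)
      · exact hempty.elim (Quot.mk _ c')
      · have : m = m' := (finCongr hf).injective (Subsingleton.elim _ _)
        rw [this]
  have hne : Nonempty D.Point := by
    unfold Connected at hD
    by_cases hf : D.freeCircles = 0
    · have hC : Nat.card D.Component = 1 := by omega
      obtain ⟨C⟩ := (Nat.card_eq_one_iff_unique.1 hC).2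
      induction C using Quot.ind with | _ c
      exact ⟨Sum.inl (c, 0)⟩
    · exact ⟨Sum.inr ⟨0, Nat.pos_of_ne_zero hf⟩⟩
  obtain ⟨p⟩ := hne
  rw [Nat.card_eq_one_iff_unique]
  refine ⟨⟨fun C C' => ?_⟩, ⟨x.stateGraph.connectedComponentMk (x.circleAt p)⟩⟩
  induction C using SimpleGraph.ConnectedComponent.ind with | _ u
  induction C' using SimpleGraph.ConnectedComponent.ind with | _ v
  induction u using Quot.ind
  induction v using Quot.ind
  exact SimpleGraph.ConnectedComponent.sound (hreach _ _)

/-- For a connected diagram, `jDeg` in terms of the components of the graphs of both types. -/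
theorem jDeg_eq_of_connected (hx : x.Adequate) (hD : D.Connected) :
    x.jDeg = D.writhe + x.iDeg - (Nat.card (x.colorGraph .B).ConnectedComponent -
      Nat.card (x.colorGraph .A).ConnectedComponent +
      Nat.card x.stateGraph.ConnectedComponent : ℤ) + 1 := by
  have hA := card_colorGraph_connectedComponent (x := x) .A
  have hB := card_colorGraph_connectedComponent (x := x) .B
  rw [hx.card_connectedComponent_of_connected hD, jDeg]
  push_cast
  linarith

end Zones

/-! ### Rooted enhancements -/

namespace Enhancement

/-- The circles with label `b` in the component of `u` in the graph of the arcs of type `a`. -/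
def labelled (X : x.Enhancement) (a : Smoothing) (b : Bool) (u : x.Circle) : Set x.Circle :=
  {v | (x.colorGraph a).Reachable u v ∧ X v = b}

theorem ncard_labelled_exchange (X : x.Enhancement) (c : Fin D.crossings) (b : Bool)
    (u : x.Circle) : ((X.exchange c).labelled (x c) b u).ncard = (X.labelled (x c) b u).ncard := by
  classical
  have hends := colorGraph_reachable_ends (x := x) c
  have hreach : ∀ v, (x.colorGraph (x c)).Reachable v (Equiv.swap (x.end₀ c) (x.end₂ c) v) := by
    intro v
    rw [Equiv.swap_apply_def]
    split_ifs with h₀ h₂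
    · rw [h₀]; exact hends
    · rw [h₂]; exact hends.symm
    · exact .refl _
  have : (X.exchange c).labelled (x c) b u =
      Equiv.swap (x.end₀ c) (x.end₂ c) ⁻¹' X.labelled (x c) b u := by
    ext v
    refine and_congr_left fun _ => ⟨fun h => h.trans (hreach v), fun h => h.trans (hreach v).symm⟩
  rw [this]
  exact Set.ncard_preimage_of_injective_subset_range (Equiv.injective _) (by simp)

/-- Every label `0` is carried by the lowest circle of its component in the graph of the `A`-type
arcs, and every label `1` by the lowest circle of its component in the graph of the `B`-type
arcs. -/
structure IsRooted (X : x.Enhancement) (h : x.Circle → ℕ) : Prop where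
  isLocalMin_A : ∀ u, X u = false → IsLocalMin (x.colorGraph .A) h u
  isLocalMin_B : ∀ u, X u = true → IsLocalMin (x.colorGraph .B) h u

variable {r : x.stateGraph.ConnectedComponent → x.Circle} {X : x.Enhancement}

theorem ncard_labelled_le_one (hx : x.HomogeneouslyAdequate)
    (hr : ∀ C, x.stateGraph.connectedComponentMk (r C) = C) {a : Smoothing} {b : Bool}
    (hX : ∀ u, X u = b → IsLocalMin (x.colorGraph a) (height r) u) (u : x.Circle) :
    (X.labelled a b u).ncard ≤ 1 := by
  rw [Set.ncard_le_one]
  rintro v ⟨huv, hv⟩ w ⟨huw, hw⟩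
  by_contra hne
  have hvw := huv.symm.trans huw
  exact lt_asymm (IsLocalMin.height_lt hx.monochromaticBlocks hr (hX v hv) hvw (Ne.symm hne))
    (IsLocalMin.height_lt hx.monochromaticBlocks hr (hX w hw) hvw.symm hne)

/-- If `X` and `Y` agree on all circles of a component except possibly on `u`, and if they have
equally many labels `b` there, then they also agree on `u`. -/
theorem eq_of_ncard_labelled_eq {Y : x.Enhancement} {a : Smoothing} {b : Bool} {u : x.Circle}
    (hcard : (Y.labelled a b u).ncard = (X.labelled a b u).ncard)
    (h : ∀ v, (x.colorGraph a).Reachable u v → v ≠ u → Y v = X v) : Y u = X u := by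
  have key : ∀ Z Z' : x.Enhancement, (Z.labelled a b u).ncard = (Z'.labelled a b u).ncard →
      (∀ v, (x.colorGraph a).Reachable u v → v ≠ u → Z v = Z' v) → Z u = b → Z' u = b := by
    intro Z Z' hcard h hZ
    by_contra hZ'
    refine hcard.not_gt (Set.ncard_lt_ncard ?_ (Set.toFinite _))
    refine ⟨fun v hv => ?_, fun hsub => hZ' (hsub (a := u) ⟨.refl _, hZ⟩).2⟩
    have hvu : v ≠ u := fun hvu => hZ' (hvu ▸ hv.2)
    exact ⟨hv.1, (h v hv.1 hvu).trans hv.2⟩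
  have h1 := key Y X hcard h
  have h2 := key X Y hcard.symm fun v hv hvu => (h v hv hvu).symm
  cases b <;> cases hY : Y u <;> cases hX : X u <;> simp_all

/-- An enhancement is determined by the number of labels `0` in each component of the graph of the
`A`-type arcs together with the number of labels `1` in each component of the graph of the `B`-type
arcs: at the highest circle where two such enhancements differ, one of the counts differs. -/
theorem eq_of_forall_ncard_labelled_eq (hx : x.HomogeneouslyAdequate) {Y : x.Enhancement}
    (hA : ∀ u, (Y.labelled .A false u).ncard = (X.labelled .A false u).ncard)
    (hB : ∀ u, (Y.labelled .B true u).ncard = (X.labelled .B true u).ncard) : Y = X := by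
  by_contra hne
  obtain ⟨u₀, hu₀⟩ := Function.ne_iff.1 hne
  obtain ⟨r, hr, -⟩ := exists_root (G := x.stateGraph) u₀
  obtain ⟨u, hu, hmax⟩ := Set.exists_max_image {u | Y u ≠ X u} (height r) (Set.toFinite _)
    ⟨u₀, hu₀⟩
  have hagree : ∀ a, IsLocalMin (x.colorGraph a) (height r) u →
      ∀ v, (x.colorGraph a).Reachable u v → v ≠ u → Y v = X v := by
    intro a ha v hv hvu
    by_contra h
    exact (hmax v h).not_gt (IsLocalMin.height_lt hx.monochromaticBlocks hr ha hv hvu)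
  obtain h | h := isLocalMin_or hx.monochromaticBlocks hr u
  · exact hu (eq_of_ncard_labelled_eq (hA u) (hagree _ h))
  · exact hu (eq_of_ncard_labelled_eq (hB u) (hagree _ h))

/-- A signed `A`-trace of a rooted enhancement `X` represents a nonzero class. It is not a boundary
because the functional that sums over all enhancements with as many labels `1` as `X` in each
component of the graph of the `B`-type arcs vanishes on boundaries, whereas `X` is the only
enhancement of this kind that is `A`-equivalent to `X`. -/
theorem IsRooted.representsNonzero {R : Type} [Ring R] (ρ : R →+* ZMod 2)
    (hx : x.HomogeneouslyAdequate) (hr : ∀ C, x.stateGraph.connectedComponentMk (r C) = C)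
    (hX : X.IsRooted (height r)) {f : x.Enhancement → R}
    (hf : ∀ Y, ¬ X.AEquiv Y → f Y = 0)
    (hf_neg : ∀ Y c, X.AEquiv Y → x c = .A → Y (x.end₀ c) ≠ Y (x.end₂ c) →
      f (Y.exchange c) = - f Y) (hfX : ρ (f X) = 1) :
    RepresentsNonzero R (∑ Y, Finsupp.single (⟨x, Y⟩ : D.EnhancedState) (f Y)) := by
  classical
  have hA : ∀ Y, X.AEquiv Y →
      ∀ u, (Y.labelled .A false u).ncard = (X.labelled .A false u).ncard := fun Y hY u =>
    hY.eq_of_exchange (F := fun Y => (Y.labelled .A false u).ncard)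
      fun Y c hc => hc ▸ ncard_labelled_exchange Y c false u
  have not_both : ∀ (Y : x.Enhancement) (b : Bool) (c : Fin D.crossings),
      (Y.labelled (x c) b (x.end₀ c)).ncard ≤ 1 → Y (x.end₀ c) = b → Y (x.end₂ c) = b → False :=
    fun Y b c hcard h₀ h₂ => hx.1 c <| (Set.ncard_le_one).1 hcard _ ⟨.refl _, h₀⟩ _
      ⟨colorGraph_reachable_ends c, h₂⟩
  refine representsNonzero_of_notMem_range (d_sum_single_eq_zero hx.1 ?_ ?_) ?_
  · intro Y c hc h₀ h₂
    refine hf Y fun hY => not_both Y false c ?_ h₀ h₂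
    rw [hc, hA Y hY]
    exact ncard_labelled_le_one hx hr hX.isLocalMin_A _
  · intro Y c hc hne
    by_cases hY : X.AEquiv Y
    · exact hf_neg Y c hY hc hne
    · rw [hf Y hY, hf _ fun h => hY ((aEquiv_exchange_iff X Y hc).1 h), neg_zero]
  · rintro ⟨w, hw⟩
    let S : Finset x.Enhancement :=
      {Z | ∀ u, (Z.labelled .B true u).ncard = (X.labelled .B true u).ncard}
    have hS : ∀ Z, Z ∈ S ↔ ∀ u, (Z.labelled .B true u).ncard = (X.labelled .B true u).ncard := by
      simp [S]
    have h0 : coeffSum ρ S (d R D w) = 0 := by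
      refine coeffSum_d ρ hx.1 ?_ ?_ w
      · rintro Z hZ c hc ⟨h₀, h₂⟩
        refine not_both Z true c ?_ h₀ h₂
        rw [hc, (hS Z).1 hZ]
        exact ncard_labelled_le_one hx hr hX.isLocalMin_B _
      · intro Z hZ c hc
        rw [hS] at hZ ⊢
        intro u
        rw [← hZ u, ← hc]
        exact ncard_labelled_exchange Z c true u
    have hcoeff : ∀ Z : x.Enhancement,
        (∑ Y, Finsupp.single (⟨x, Y⟩ : D.EnhancedState) (f Y)) ⟨x, Z⟩ = f Z := by
      intro Z
      rw [Finsupp.finsetSum_apply, Finset.sum_eq_single Z]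
      · simp
      · intro Y _ hYZ
        exact Finsupp.single_eq_of_ne fun h => hYZ (by simpa using h.symm)
      · exact fun h => absurd (Finset.mem_univ _) h
    rw [hw, coeffSum, Finset.sum_eq_single X, hcoeff, hfX] at h0
    · exact one_ne_zero h0
    · intro Z hZ hne
      rw [hcoeff, hf, map_zero]
      exact fun hAZ => hne (eq_of_forall_ncard_labelled_eq hx (hA Z hAZ) ((hS Z).1 hZ))
    · exact fun h => absurd ((hS X).2 fun _ => rfl) h

theorem sum_single_mem_chains {R : Type} [Ring R] {f : x.Enhancement → R}
    (hf : ∀ Y, ¬ X.AEquiv Y → f Y = 0) :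
    ∑ Y, Finsupp.single (⟨x, Y⟩ : D.EnhancedState) (f Y) ∈ x.chains R x.iDeg X.jDeg := by
  refine Submodule.sum_mem _ fun Y _ => ?_
  by_cases hY : X.AEquiv Y
  · rw [← mul_one (f Y), ← smul_eq_mul, ← Finsupp.smul_single]
    exact Submodule.smul_mem _ _ (Submodule.subset_span ⟨Y, rfl, hY.jDeg_eq, rfl⟩)
  · rw [hf Y hY, Finsupp.single_zero]
    exact Submodule.zero_mem _

theorem IsRooted.trF₂ (hx : x.HomogeneouslyAdequate)
    (hr : ∀ C, x.stateGraph.connectedComponentMk (r C) = C) (hX : X.IsRooted (height r)) :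
    X.trF₂ ∈ x.chains (ZMod 2) x.iDeg X.jDeg ∧ RepresentsNonzero (ZMod 2) X.trF₂ := by
  classical
  have htr : X.trF₂ = ∑ Y, Finsupp.single (⟨x, Y⟩ : D.EnhancedState)
      (if X.AEquiv Y then (1 : ZMod 2) else 0) := by
    rw [Enhancement.trF₂, Finset.sum_filter]
    refine Finset.sum_congr rfl fun Y _ => ?_
    split_ifs <;> simp
  rw [htr]
  refine ⟨sum_single_mem_chains fun Y hY => if_neg hY,
    hX.representsNonzero (RingHom.id _) hx hr (fun Y hY => if_neg hY) ?_ ?_⟩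
  · intro Y c hY hc _
    rw [if_pos hY, if_pos ((aEquiv_exchange_iff X Y hc).2 hY)]
    decide
  · simp [show X.AEquiv X from Relation.EqvGen.refl X]

/-! ### The sign of an `A`-equivalence -/

section Sign

/-- The number modulo `2` of circles with label `0` that have colour `true` under `g`. -/
noncomputable def zeroParity (g : x.Circle → Bool) (X : x.Enhancement) : ZMod 2 :=
  letI := Fintype.ofFinite x.Circle
  ∑ u, if X u = false ∧ g u = true then 1 else 0

theorem zeroParity_exchange {g : x.Circle → Bool} {c : Fin D.crossings}
    (hg : g (x.end₀ c) ≠ g (x.end₂ c)) (hX : X (x.end₀ c) ≠ X (x.end₂ c)) :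
    zeroParity g (X.exchange c) = zeroParity g X + 1 := by
  let := Fintype.ofFinite x.Circle
  rw [← sub_eq_iff_eq_add', zeroParity, zeroParity, ← Finset.sum_sub_distrib,
    Fintype.sum_eq_add (x.end₀ c) (x.end₂ c) (fun h => hX (by rw [h]))]
  · rw [exchange_end₀, exchange_end₂]
    cases hX₀ : X (x.end₀ c) <;> cases hX₂ : X (x.end₂ c) <;> cases hg₀ : g (x.end₀ c) <;>
      cases hg₂ : g (x.end₂ c) <;> simp_all
  · rintro u ⟨h₀, h₂⟩
    rw [exchange_of_ne X h₀ h₂, sub_self]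

theorem ASteps.zeroParity_eq {g : x.Circle → Bool}
    (hg : ∀ c, x c = .A → g (x.end₀ c) ≠ g (x.end₂ c)) {k : ℕ} {X Y : x.Enhancement}
    (h : ASteps k X Y) : zeroParity g Y = zeroParity g X + k := by
  induction h with
  | refl => simp
  | step _ hmove ih =>
    obtain ⟨c, hc, hne, rfl⟩ := aMove_iff.1 hmove
    rw [zeroParity_exchange (hg c hc) hne, ih]
    push_cast
    ring

theorem AMove.symm {X Y : x.Enhancement} (h : X.AMove Y) : Y.AMove X := by
  obtain ⟨c, hc, hne, rfl⟩ := aMove_iff.1 h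
  exact aMove_iff.2 ⟨c, hc, by simpa using hne.symm, by simp⟩

theorem ASteps.trans {k l : ℕ} {X Y Z : x.Enhancement} (h : ASteps k X Y) (h' : ASteps l Y Z) :
    ASteps (k + l) X Z := by
  induction h' with
  | refl => exact h
  | step _ hmove ih => exact .step (ih h) hmove

theorem ASteps.symm {k : ℕ} {X Y : x.Enhancement} (h : ASteps k X Y) : ASteps k Y X := by
  induction h with
  | refl => exact .refl _
  | step _ hmove ih =>
    rw [Nat.add_comm]
    exact ((ASteps.refl _).step hmove.symm).trans ih

theorem AEquiv.exists_aSteps {X Y : x.Enhancement} (h : X.AEquiv Y) : ∃ k, ASteps k X Y := by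
  induction h with
  | rel X Y h => exact ⟨1, (ASteps.refl _).step h⟩
  | refl X => exact ⟨0, .refl X⟩
  | symm X Y _ ih => exact ih.imp fun _ h => h.symm
  | trans X Y Z _ _ ih₁ ih₂ =>
    obtain ⟨k, hk⟩ := ih₁
    obtain ⟨l, hl⟩ := ih₂
    exact ⟨k + l, hk.trans hl⟩

/-- If the `A`-type arcs are properly coloured by `g`, then every move changes `zeroParity g`, so the
sign is determined by this invariant. -/
theorem AEquiv.sgn_eq {g : x.Circle → Bool}
    (hg : ∀ c, x c = .A → g (x.end₀ c) ≠ g (x.end₂ c)) {X Y : x.Enhancement} (h : X.AEquiv Y) :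
    X.sgn Y = if zeroParity g Y = zeroParity g X then 1 else -1 := by
  classical
  unfold sgn
  refine if_congr ⟨?_, fun heq => ?_⟩ rfl rfl
  · rintro ⟨k, hk, hsteps⟩
    rw [hsteps.zeroParity_eq hg, (ZMod.natCast_eq_zero_iff_even).2 hk, add_zero]
  · obtain ⟨k, hk⟩ := h.exists_aSteps
    refine ⟨k, (ZMod.natCast_eq_zero_iff_even).1 ?_, hk⟩
    rwa [hk.zeroParity_eq hg, add_eq_left] at heq

end Sign

/-! ### The enhancements attached to a choice of roots -/

theorem IsRooted.trℤ (hx : x.HomogeneouslyAdequate)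
    (hr : ∀ C, x.stateGraph.connectedComponentMk (r C) = C) (hX : X.IsRooted (height r))
    (hbip : x.BipartiteA) :
    X.trℤ ∈ x.chains ℤ x.iDeg X.jDeg ∧ RepresentsNonzero ℤ X.trℤ := by
  classical
  obtain ⟨g, hg⟩ := hbip
  have htr : X.trℤ = ∑ Y, Finsupp.single (⟨x, Y⟩ : D.EnhancedState)
      (if X.AEquiv Y then X.sgn Y else 0) := by
    rw [Enhancement.trℤ, Finset.sum_filter]
    refine Finset.sum_congr rfl fun Y _ => ?_
    split_ifs <;> simp
  rw [htr]
  refine ⟨sum_single_mem_chains fun Y hY => if_neg hY,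
    hX.representsNonzero (Int.castRingHom _) hx hr (fun Y hY => if_neg hY) ?_ ?_⟩
  · intro Y c hY hc hne
    have hY' := (aEquiv_exchange_iff X Y hc).2 hY
    rw [if_pos hY, if_pos hY', hY.sgn_eq hg, hY'.sgn_eq hg, zeroParity_exchange (hg c hc) hne]
    generalize zeroParity g Y = s
    generalize zeroParity g X = t
    revert s t
    decide
  · have hXX : X.AEquiv X := Relation.EqvGen.refl X
    simp [hXX, hXX.sgn_eq hg]

variable (r) in
open Classical in
/-- The enhancement with label `0` on those circles that an arc of type `B` joins to a lower circle,
and label `1` on all others. -/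
noncomputable def rooted : x.Enhancement :=
  fun u => decide (IsLocalMin (x.colorGraph .B) (height r) u)

theorem isRooted_rooted (hx : x.HomogeneouslyAdequate)
    (hr : ∀ C, x.stateGraph.connectedComponentMk (r C) = C) :
    (rooted r).IsRooted (height r) where
  isLocalMin_A u hu :=
    (isLocalMin_or hx.monochromaticBlocks hr u).resolve_right (by simpa [rooted] using hu)
  isLocalMin_B u hu := by simpa [rooted] using hu

theorem tau_rooted (hx : x.HomogeneouslyAdequate)
    (hr : ∀ C, x.stateGraph.connectedComponentMk (r C) = C) :
    (rooted r).tau = Nat.card (x.colorGraph .B).ConnectedComponent -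
      Nat.card (x.colorGraph .A).ConnectedComponent +
      Nat.card x.stateGraph.ConnectedComponent := by
  have hG := hx.monochromaticBlocks
  simp only [tau, rooted, decide_eq_true_eq, decide_eq_false_iff_not]
  rw [ncard_isLocalMin hG hr, ncard_not_isLocalMin_B hG hr]
  ring

open Classical in
theorem tau_update_false {u : x.Circle} (hu : X u = true) :
    tau (Function.update X u false) = X.tau - 2 := by
  have h1 : {v | Function.update X u false v = true} = {v | X v = true} \ {u} := by
    ext v
    by_cases hv : v = u <;> simp [hv]
  have h2 : {v | Function.update X u false v = false} = insert u {v | X v = false} := by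
    ext v
    by_cases hv : v = u <;> simp [hv]
  have h3 := Set.ncard_sdiff_singleton_add_one (s := {v | X v = true}) hu (Set.toFinite _)
  rw [tau, tau, h1, h2, Set.ncard_insert_of_notMem (by simp [hu]), ← h3]
  push_cast
  ring

end Enhancement

end State

end LinkDiagram

/-! ### Nonzero classes of homogeneously adequate states -/

open LinkDiagram State Enhancement in
theorem mainTheorem1 (D : LinkDiagram) (x : D.State) (hx : x.HomogeneouslyAdequate) :
    ∃ j : ℤ, (D.Connected → j = x.jDeg) ∧
      ∀ p : D.Point, ∃ Xm Xp : x.Enhancement,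
        Xm (x.circleAt p) = true ∧ Xp (x.circleAt p) = false ∧
        (∀ u, u ≠ x.circleAt p → Xm u = Xp u) ∧
        Xm.jDeg = j - 1 ∧ Xp.jDeg = j + 1 ∧
        (Xm.trF₂ ∈ x.chains (ZMod 2) x.iDeg (j - 1) ∧
          LinkDiagram.RepresentsNonzero (ZMod 2) Xm.trF₂) ∧
        (Xp.trF₂ ∈ x.chains (ZMod 2) x.iDeg (j + 1) ∧
          LinkDiagram.RepresentsNonzero (ZMod 2) Xp.trF₂) ∧
        (x.BipartiteA →
          (Xm.trℤ ∈ x.chains ℤ x.iDeg (j - 1) ∧ LinkDiagram.RepresentsNonzero ℤ Xm.trℤ) ∧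
          (Xp.trℤ ∈ x.chains ℤ x.iDeg (j + 1) ∧ LinkDiagram.RepresentsNonzero ℤ Xp.trℤ)) := by
  classical
  refine ⟨_, fun hD => (jDeg_eq_of_connected hx.1 hD).symm, fun p => ?_⟩
  -- All components are rooted arbitrarily, except that the one containing `p` is rooted there.
  obtain ⟨r, hr, hrp⟩ := exists_root (G := x.stateGraph) (x.circleAt p)
  obtain ⟨hpA, hpB⟩ := (isLocalMin_and_iff hx.monochromaticBlocks hr _).2 hrp
  have hm := isRooted_rooted hx hr
  have hmp : rooted r (x.circleAt p) = true := decide_eq_true hpB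
  -- The root is a local minimum for both types, so either label is allowed on it.
  have hp : IsRooted (Function.update (rooted r) (x.circleAt p) false) (height r) := by
    refine ⟨fun u hu => ?_, fun u hu => ?_⟩ <;> by_cases hup : u = x.circleAt p
    · exact hup ▸ hpA
    · exact hm.isLocalMin_A u (by rwa [Function.update_of_ne hup] at hu)
    · exact hup ▸ hpB
    · exact hm.isLocalMin_B u (by rwa [Function.update_of_ne hup] at hu)
  have htau := tau_rooted hx hr
  have hjm : Enhancement.jDeg (rooted r) = D.writhe + x.iDeg -
      (Nat.card (x.colorGraph .B).ConnectedComponent -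
      Nat.card (x.colorGraph .A).ConnectedComponent +
      Nat.card x.stateGraph.ConnectedComponent : ℤ) + 1 - 1 := by
    rw [Enhancement.jDeg, htau]
    ring
  have hjp : Enhancement.jDeg (Function.update (rooted r) (x.circleAt p) false) =
      D.writhe + x.iDeg - (Nat.card (x.colorGraph .B).ConnectedComponent -
      Nat.card (x.colorGraph .A).ConnectedComponent +
      Nat.card x.stateGraph.ConnectedComponent : ℤ) + 1 + 1 := by
    rw [Enhancement.jDeg, tau_update_false hmp, htau]
    ring
  refine ⟨rooted r, Function.update (rooted r) (x.circleAt p) false, hmp, by simp,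
    fun u hu => by rw [Function.update_of_ne hu], hjm, hjp, ?_, ?_, fun hbip => ⟨?_, ?_⟩⟩
  · exact hjm ▸ hm.trF₂ hx hr
  · exact hjp ▸ hp.trF₂ hx hr
  · exact hjm ▸ hm.trℤ hx hr hbip
  · exact hjp ▸ hp.trℤ hx hr hbip
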